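/- Let $X$ be a locally compact Polish space with Borel $\sigma$-algebra $\mathcal B(X)$, let $\mathbb R_+^*=(0,\infty)$, and let $\nu$ and $\sigma$ be non-atomic (non-negative) Radon measures on $\mathbb R_+^*$ and $X$, respectively, with $\int_{\mathbb R_+^*}s\,d\nu(s)<\infty$. Let $\Gamma(\mathbb R_+^*\times X)$ be the set of all $\gamma\subset\mathbb R_+^*\times X$ such that $\gamma\cap([a,b]\times\Lambda)$ is finite for all $0<a<b<\infty$ and all $\Lambda\in\mathcal B(X)$ with compact closure; identify $\gamma$ with the measure $\sum_{y\in\gamma}\delta_y$ and equip $\Gamma(\mathbb R_+^*\times X)$ with the Borel $\sigma$-algebra of the vague topology. Let $\pi_{\nu\otimes\sigma}$ be the Poisson measure on $\Gamma(\mathbb R_+^*\times X)$ with intensity $\nu\otimes\sigma$, i.e. the probability measure satisfying $$\int e^{-\langle\gamma,f\rangle}\,d\pi_{\nu\otimes\sigma}(\gamma)=\exp\Bigl(\int_{\mathbb R_+^*\times X}(e^{-f(s,x)}-1)\,d(\nu\otimes\sigma)(s,x)\Bigr)$$ for all continuous compactly supported $f:\mathbb R_+^*\times X\to[0,\infty)$.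 Let $\mathbb K(X)$ be the cone of non-negative discrete Radon measures $\eta=\sum_i s_i\delta_{x_i}$ on $X$ (at most countably many distinct atoms $x_i\in X$, weights $s_i>0$; the zero measure is included), with the Borel $\sigma$-algebra of the vague topology, and let $\tau(\eta)=\{x\in X:\eta(\{x\})>0\}$. Let $\Pi$ be the (measurable) set of all $\gamma\in\Gamma(\mathbb R_+^*\times X)$ such that $(s_1,x),(s_2,x)\in\gamma$ implies $s_1=s_2$ and such that $\sum_{(s,x)\in\gamma}s\mathbf 1_\Lambda(x)<\infty$ for every $\Lambda\in\mathcal B(X)$ with compact closure. Let $\pi_{\mathbb K,\nu\otimes\sigma}$ be the image of $\pi_{\nu\otimes\sigma}$, regarded as a measure on $\Pi$, under the map $\Pi\to\mathbb K(X)$, $\gamma\mapsto\sum_{(s,x)\in\gamma}s\,\delta_x$. Suppose that $\nu(\mathbb R_+^*)=\infty$. Then for every $\Lambda\in\mathcal B(X)$ with compact closure and $\sigma(\Lambda)>0$, the set $\tau(\eta)\cap\Lambda$ is infinite for $\pi_{\mathbb K,\nu\otimes\sigma}$-almost every $\eta\in\mathbb K(X)$. -/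

import Mathlib

open MeasureTheory Set Filter Topology
open scoped ENNReal CompactlySupported

namespace DiscreteCone

/-- The vague topology on a family `m : T → Measure Y` of measures on `Y`: the coarsest topology
on `T` for which `t ↦ ∫ f d(m t)` is continuous for every continuous compactly supported
`f : Y → ℝ`. -/
@[reducible]
noncomputable def vagueTopology {T Y : Type*} [TopologicalSpace Y] [MeasurableSpace Y]
    (m : T → Measure Y) : TopologicalSpace T :=
  ⨅ f : C_c(Y, ℝ), TopologicalSpace.induced (fun t => ∫ y, f y ∂(m t)) inferInstance

/-- The Borel `σ`-algebra of the vague topology. -/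
@[reducible]
noncomputable def vagueBorel {T Y : Type*} [TopologicalSpace Y] [MeasurableSpace Y]
    (m : T → Measure Y) : MeasurableSpace T :=
  @borel T (vagueTopology m)

theorem exists_countable_determining (Y : Type*) [TopologicalSpace Y] [T2Space Y]
    [LocallyCompactSpace Y] [SecondCountableTopology Y] :
    ∃ D : Set C_c(Y, ℝ), D.Countable ∧ ∀ f : C_c(Y, ℝ), ∃ χ ∈ D, (∀ y, 0 ≤ χ y) ∧
      ∀ ε : ℝ, 0 < ε → ∃ g ∈ D, ∀ y, |f y - g y| ≤ ε * χ y := by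
  have E : CompactExhaustion Y := default
  have hb : ∀ n, ∃ χ : C_c(Y, ℝ), (∀ y, 0 ≤ χ y) ∧ ∀ y ∈ E n, χ y = 1 := by
    intro n
    obtain ⟨f, h1, -, hc, h01⟩ := exists_continuous_one_zero_of_isCompact (E.isCompact n)
      isClosed_empty (disjoint_empty _)
    exact ⟨⟨f, hc⟩, fun y => (h01 y).1, fun y hy => h1 hy⟩
  choose χ hχ0 hχ1 using hb
  let S : ℕ → Set C_c(Y, ℝ) := fun n => {f | tsupport f ⊆ E n}
  have hd : ∀ n, ∃ D : Set C_c(Y, ℝ), D.Countable ∧ D ⊆ S n ∧ ∀ f ∈ S n, ∀ ε : ℝ, 0 < ε →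
      ∃ g ∈ D, ∀ y ∈ E n, |f y - g y| ≤ ε := by
    intro n
    let j : S n → C(Y, ℝ) := fun f => f.1.toContinuousMap
    let : TopologicalSpace (S n) := TopologicalSpace.induced j inferInstance
    have hj : IsInducing j := ⟨rfl⟩
    have : SecondCountableTopology (S n) := hj.secondCountableTopology
    obtain ⟨c, hc, hdense⟩ := TopologicalSpace.exists_countable_dense (S n)
    refine ⟨Subtype.val '' c, hc.image _, ?_, ?_⟩
    · rintro _ ⟨g, -, rfl⟩
      exact g.2
    · intro f hf ε hε
      have hU : {h : S n | ∀ y ∈ E n, |f y - h.1 y| < ε} ∈ 𝓝 (⟨f, hf⟩ : S n) := by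
        have h1 : Tendsto j (𝓝 (⟨f, hf⟩ : S n)) (𝓝 (j ⟨f, hf⟩)) := hj.continuous.continuousAt
        rw [ContinuousMap.tendsto_iff_forall_isCompact_tendstoUniformlyOn] at h1
        have h2 := Metric.tendstoUniformlyOn_iff.1 (h1 _ (E.isCompact n)) ε hε
        exact h2
      obtain ⟨h, hhU, hhc⟩ := hdense.inter_nhds_nonempty hU
      exact ⟨h.1, ⟨h, hhU, rfl⟩, fun y hy => (hhc y hy).le⟩
  choose D hDc hDS hD using hd
  refine ⟨range χ ∪ ⋃ n, D n, (countable_range χ).union (countable_iUnion hDc), fun f => ?_⟩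
  obtain ⟨n, hn⟩ := E.exists_superset_of_isCompact f.hasCompactSupport'
  refine ⟨χ n, Or.inl ⟨n, rfl⟩, hχ0 n, fun ε hε => ?_⟩
  obtain ⟨g, hg, hfg⟩ := hD n f hn ε hε
  refine ⟨g, Or.inr (mem_iUnion.2 ⟨n, hg⟩), fun y => ?_⟩
  by_cases hy : y ∈ E n
  · simpa [hχ1 n y hy] using hfg y hy
  · have h1 : f y = 0 := image_eq_zero_of_notMem_tsupport fun h => hy (hn h)
    have h2 : g y = 0 := image_eq_zero_of_notMem_tsupport fun h => hy (hDS n hg h)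
    simpa [h1, h2] using mul_nonneg hε.le (hχ0 n y)

theorem continuous_vague_integral {T Y : Type*} [TopologicalSpace Y] [MeasurableSpace Y]
    (m : T → Measure Y) (f : C_c(Y, ℝ)) :
    @Continuous T ℝ (vagueTopology m) _ (fun t => ∫ y, f y ∂(m t)) :=
  continuous_iInf_dom (i := f) continuous_induced_dom

theorem vagueBorel_le {T Y : Type*} [TopologicalSpace Y] [T2Space Y]
    [LocallyCompactSpace Y] [SecondCountableTopology Y] [MeasurableSpace Y] [BorelSpace Y]
    (m : T → Measure Y) (hm : ∀ t, IsFiniteMeasureOnCompacts (m t)) :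
    vagueBorel m ≤ MeasurableSpace.comap m inferInstance := by
  obtain ⟨D, hDc, hD⟩ := exists_countable_determining Y
  have hint : ∀ (f : C_c(Y, ℝ)) t, Integrable f (m t) := fun f t =>
    f.continuous.integrable_of_hasCompactSupport f.hasCompactSupport'
  let Φ : T → (D → ℝ) := fun t d => ∫ y, d.1 y ∂(m t)
  have hle : TopologicalSpace.induced Φ inferInstance ≤ vagueTopology m := by
    refine le_iInf fun f => ?_
    rw [← continuous_iff_le_induced]
    let : TopologicalSpace T := TopologicalSpace.induced Φ inferInstance
    have hΦ : ∀ d ∈ D, Continuous fun t => ∫ y, d y ∂(m t) := fun d hd =>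
      (continuous_apply (⟨d, hd⟩ : D)).comp (continuous_induced_dom (f := Φ))
    obtain ⟨χ, hχD, hχ0, hχ⟩ := hD f
    refine continuous_of_locally_uniform_approx_of_continuousAt fun t₀ u hu => ?_
    obtain ⟨ε, hε, hεu⟩ := Metric.mem_uniformity_dist.1 hu
    set M := ∫ y, χ y ∂(m t₀) with hM
    have hM0 : 0 ≤ M := integral_nonneg hχ0
    obtain ⟨g, hgD, hg⟩ := hχ (ε / (M + 2)) (by positivity)
    refine ⟨{t | ∫ y, χ y ∂(m t) < M + 1},
      (hΦ χ hχD).continuousAt.eventually_lt continuousAt_const (by linarith),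
      fun t => ∫ y, g y ∂(m t), (hΦ g hgD).continuousAt, fun t ht => hεu ?_⟩
    rw [Real.dist_eq, ← integral_sub (hint f t) (hint g t)]
    calc |∫ y, (f y - g y) ∂(m t)| ≤ ∫ y, |f y - g y| ∂(m t) := abs_integral_le_integral_abs
      _ ≤ ∫ y, ε / (M + 2) * χ y ∂(m t) :=
        integral_mono ((hint f t).sub (hint g t)).abs ((hint χ t).const_mul _) hg
      _ = ε / (M + 2) * ∫ y, χ y ∂(m t) := integral_const_mul _ _
      _ ≤ ε / (M + 2) * (M + 1) := by gcongr; exact le_of_lt ht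
      _ < ε := by
        rw [div_mul_eq_mul_div, div_lt_iff₀ (by positivity)]
        nlinarith
  have : Countable D := hDc.to_subtype
  calc vagueBorel m ≤ @borel T (TopologicalSpace.induced Φ inferInstance) := borel_anti hle
    _ = MeasurableSpace.comap Φ inferInstance := by
      rw [borel_comap, ← BorelSpace.measurable_eq]
    _ ≤ _ := by
      rw [← measurable_iff_comap_le]
      let : MeasurableSpace T := MeasurableSpace.comap m inferInstance
      have hmm : Measurable m := comap_measurable m
      refine measurable_pi_lambda _ fun d => ?_
      have : (fun t => Φ t d) = fun t => (∫⁻ y, ENNReal.ofReal (d.1 y) ∂(m t)).toReal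
          - (∫⁻ y, ENNReal.ofReal (-d.1 y) ∂(m t)).toReal := by
        ext t
        exact integral_eq_lintegral_pos_part_sub_lintegral_neg_part (hint d.1 t)
      rw [this]
      have hdm : Measurable d.1 := d.1.continuous.measurable
      exact (((Measure.measurable_lintegral hdm.ennreal_ofReal).comp hmm).ennreal_toReal).sub
        ((Measure.measurable_lintegral hdm.neg.ennreal_ofReal).comp hmm).ennreal_toReal

theorem measurable_vagueBorel {T Y : Type*} [TopologicalSpace Y] [T2Space Y]
    [LocallyCompactSpace Y] [SecondCountableTopology Y] [MeasurableSpace Y] [BorelSpace Y]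
    (m : T → Measure Y) (hm : ∀ t, IsFiniteMeasureOnCompacts (m t)) :
    @Measurable T (Measure Y) (vagueBorel m) _ m := by
  let : TopologicalSpace T := vagueTopology m
  let : MeasurableSpace T := vagueBorel m
  have : BorelSpace T := ⟨rfl⟩
  let := TopologicalSpace.metrizableSpaceMetric Y
  have hK : ∀ K : Set Y, IsCompact K → Measurable fun t => m t K := by
    intro K hK
    obtain ⟨f, hf1, -, hc, h01⟩ := exists_continuous_one_zero_of_isCompact_of_isGδ hK
      hK.isClosed.isGδ isClosed_empty (disjoint_empty _)
    have hp : ∀ n : ℕ, HasCompactSupport (fun y => f y ^ (n + 1)) := fun n =>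
      hc.comp_left (g := fun x : ℝ => x ^ (n + 1)) (by simp)
    have hcont : ∀ n : ℕ, Continuous (fun y => f y ^ (n + 1)) := fun n => by fun_prop
    refine measurable_of_tendsto_metrizable (f := fun (n : ℕ) t =>
      ENNReal.ofReal (∫ y, f y ^ (n + 1) ∂(m t))) (fun n => ?_) ?_
    · exact (continuous_vague_integral m ⟨⟨_, hcont n⟩, hp n⟩).measurable.ennreal_ofReal
    · rw [tendsto_pi_nhds]
      intro t
      have hlim : Tendsto (fun n : ℕ => ∫ y, f y ^ (n + 1) ∂(m t)) atTop
          (𝓝 (∫ y, K.indicator (fun _ => (1 : ℝ)) y ∂(m t))) := by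
        refine tendsto_integral_of_dominated_convergence (fun y => f y)
          (fun n => (hcont n).aestronglyMeasurable)
          (f.continuous.integrable_of_hasCompactSupport hc) (fun n => ae_of_all _ fun y => ?_)
          (ae_of_all _ fun y => ?_)
        · rw [Real.norm_of_nonneg (pow_nonneg (h01 y).1 _)]
          exact pow_le_of_le_one (h01 y).1 (h01 y).2 (by simp)
        · by_cases hy : y ∈ K
          · have : f y = 1 := by rw [hf1] at hy; simpa using hy
            simp [hy, this]
          · have : f y ≠ 1 := fun h => hy (by rw [hf1]; simpa using h)
            rw [indicator_of_notMem hy]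
            exact (tendsto_pow_atTop_nhds_zero_of_lt_one (h01 y).1
              (lt_of_le_of_ne (h01 y).2 this)).comp (tendsto_add_atTop_nat 1)
      rw [integral_indicator hK.measurableSet, setIntegral_const, smul_eq_mul, mul_one] at hlim
      have := (ENNReal.continuous_ofReal.tendsto _).comp hlim
      rw [measureReal_def, ENNReal.ofReal_toReal hK.measure_lt_top.ne] at this
      exact this
  let C := compactCovering Y
  have hC : ∀ n, IsCompact (C n) := isCompact_compactCovering Y
  have hr : ∀ n, Measurable fun t => (m t).restrict (C n) := by
    intro n
    have : ∀ t, IsFiniteMeasure ((m t).restrict (C n)) := fun t =>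
      ⟨by simpa using (hC n).measure_lt_top⟩
    refine Measurable.measure_of_isPiSystem (S := {s | IsClosed s})
      (by rw [← borel_eq_generateFrom_isClosed]; exact BorelSpace.measurable_eq)
      isPiSystem_isClosed (fun s hs => ?_) ?_
    · simp_rw [Measure.restrict_apply hs.measurableSet]
      exact hK _ ((hC n).inter_left hs)
    · simpa using hK _ (hC n)
  refine Measure.measurable_of_measurable_coe _ fun s hs => ?_
  have : (fun t => m t s) = fun t => ⨆ n, (m t).restrict (C n) s := by
    ext t
    simp_rw [Measure.restrict_apply hs]
    rw [← (monotone_const.inter (fun a b h => compactCovering_subset Y h)).measure_iUnion,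
      ← inter_iUnion, iUnion_compactCovering, inter_univ]
  rw [this]
  exact Measurable.iSup fun n => (Measure.measurable_coe hs).comp (hr n)

/-- The half-line `(0, ∞)` with the subspace topology of `ℝ`; this is also the topology of the
logarithmic metric `|log s₁ - log s₂|`. -/
abbrev PosReal : Type := Set.Ioi (0 : ℝ)

instance : LocallyCompactSpace PosReal := isOpen_Ioi.locallyCompactSpace

section Topological

variable {X : Type*} [TopologicalSpace X] [MeasurableSpace X]

/-- Borel sets with compact closure. -/
def IsRelCompactBorel (Λ : Set X) : Prop :=
  MeasurableSet Λ ∧ IsCompact (closure Λ)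

variable (X) in
/-- The cone of nonnegative discrete Radon measures `∑ s_x δ_x` on `X`: the sum runs over an at most
countable set `S` of distinct atoms with weights `s_x > 0`. (On a locally compact Polish space a
Borel measure is Radon iff it is finite on compact sets.) -/
def Cone : Type _ :=
  {η : Measure X // IsFiniteMeasureOnCompacts η ∧
    ∃ (S : Set X) (s : X → ℝ), S.Countable ∧ (∀ x ∈ S, 0 < s x) ∧
      η = Measure.sum fun x : S => ENNReal.ofReal (s x) • Measure.dirac x.1}

/-- The cone carries the Borel `σ`-algebra of the vague topology. -/
noncomputable instance : MeasurableSpace (Cone X) := vagueBorel fun η : Cone X => η.1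

/-- The support `{x : η {x} > 0}` of a discrete measure. -/
def Cone.support (η : Cone X) : Set X := {x | 0 < η.1 {x}}

variable (X) in
/-- Locally finite configurations in `(0, ∞) × X`. -/
def Config : Type _ :=
  {γ : Set (PosReal × X) // ∀ Λ : Set X, IsRelCompactBorel Λ → ∀ a b : PosReal, a < b →
    (γ ∩ (Icc a b ×ˢ Λ)).Finite}

/-- The Radon measure `∑_{y ∈ γ} δ_y` identified with the configuration `γ`. -/
noncomputable def Config.toMeasure (γ : Config X) : Measure (PosReal × X) :=
  Measure.sum fun y : γ.1 => Measure.dirac y.1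

/-- The configuration space carries the Borel `σ`-algebra of the vague topology. -/
noncomputable instance : MeasurableSpace (Config X) := vagueBorel (Config.toMeasure (X := X))

/-- No two distinct points of `γ` have the same position. -/
def Config.IsPinpointing (γ : Config X) : Prop :=
  ∀ y ∈ γ.1, ∀ z ∈ γ.1, y.2 = z.2 → y.1 = z.1

/-- The local mass `∑_{(s, x) ∈ γ} s 1_Λ(x) ∈ [0, ∞]`. -/
noncomputable def Config.localMass (γ : Config X) (Λ : Set X) : ℝ≥0∞ :=
  ∫⁻ y, Λ.indicator (fun _ => ENNReal.ofReal (y.1 : ℝ)) y.2 ∂γ.toMeasure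

variable (X) in
/-- Pinpointing configurations with finite local mass. -/
def finiteMassConfigs : Set (Config X) :=
  {γ | γ.IsPinpointing ∧ ∀ Λ : Set X, IsRelCompactBorel Λ → γ.localMass Λ < ∞}

/-- The measure `∑_{(s, x) ∈ γ} s δ_x`. -/
noncomputable def Config.weighted (γ : Config X) : Measure X :=
  Measure.sum fun y : γ.1 => ENNReal.ofReal (y.1.1 : ℝ) • Measure.dirac y.1.2

/-- `P` is the Poisson measure on the configuration space with intensity `ρ`: the probability
measure with Laplace transform
`∫ exp (-⟨γ, f⟩) dP(γ) = exp (∫ (exp (-f) - 1) dρ)`, for all continuous compactly supported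
`f ≥ 0`. -/
structure IsPoissonMeasure (ρ : Measure (PosReal × X)) (P : Measure (Config X)) : Prop where
  isProbabilityMeasure : IsProbabilityMeasure P
  laplace : ∀ f : C_c(PosReal × X, ℝ), (∀ y, 0 ≤ f y) →
    ∫ γ, Real.exp (-∫ y, f y ∂γ.toMeasure) ∂P = Real.exp (∫ y, (Real.exp (-f y) - 1) ∂ρ)

end Topological

section Polish

variable {X : Type*} [TopologicalSpace X] [PolishSpace X] [LocallyCompactSpace X]
  [MeasurableSpace X] [BorelSpace X]

theorem Config.toMeasure_apply (γ : Config X) {A : Set (PosReal × X)} (hA : MeasurableSet A) :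
    γ.toMeasure A = ∑' y : γ.1, A.indicator 1 y.1 := by
  simp [Config.toMeasure, Measure.sum_apply _ hA, Measure.dirac_apply' _ hA]

theorem Config.toMeasure_eq_zero_iff (γ : Config X) {A : Set (PosReal × X)}
    (hA : MeasurableSet A) : γ.toMeasure A = 0 ↔ ∀ y ∈ γ.1, y ∉ A := by
  rw [γ.toMeasure_apply hA, ENNReal.tsum_eq_zero]
  simp

theorem Config.exists_box (K : Set (PosReal × X)) (hK : IsCompact K) :
    ∃ (Λ : Set X) (a b : PosReal), IsRelCompactBorel Λ ∧ a < b ∧ K ⊆ Icc a b ×ˢ Λ := by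
  have h2 : IsCompact (Prod.snd '' K) := hK.image continuous_snd
  obtain ⟨a, ha⟩ := (hK.image continuous_fst).bddBelow
  obtain ⟨b, hb⟩ := (hK.image continuous_fst).bddAbove
  refine ⟨Prod.snd '' K, a, ⟨max a.1 b.1 + 1, ?_⟩, ⟨h2.measurableSet, by rwa [h2.isClosed.closure_eq]⟩,
    ?_, ?_⟩
  · have : (0 : ℝ) < a.1 := a.2
    have := le_max_left a.1 b.1
    show (0 : ℝ) < _
    linarith
  · show a.1 < max a.1 b.1 + 1
    have := le_max_left a.1 b.1
    linarith
  · intro y hy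
    refine ⟨⟨ha (mem_image_of_mem _ hy), ?_⟩, mem_image_of_mem _ hy⟩
    have h3 : y.1.1 ≤ b.1 := hb (mem_image_of_mem _ hy)
    show y.1.1 ≤ max a.1 b.1 + 1
    have := le_max_right a.1 b.1
    linarith

theorem Config.finite_inter (γ : Config X) {K : Set (PosReal × X)} (hK : IsCompact K) :
    (γ.1 ∩ K).Finite := by
  obtain ⟨Λ, a, b, hΛ, hab, h⟩ := Config.exists_box K hK
  exact (γ.2 Λ hΛ a b hab).subset (inter_subset_inter_right _ h)

theorem Config.countable (γ : Config X) : γ.1.Countable := by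
  have : γ.1 = ⋃ n, γ.1 ∩ compactCovering (PosReal × X) n := by
    rw [← inter_iUnion, iUnion_compactCovering, inter_univ]
  rw [this]
  exact countable_iUnion fun n => (γ.finite_inter (isCompact_compactCovering _ n)).countable

theorem Config.isFiniteMeasureOnCompacts (γ : Config X) :
    IsFiniteMeasureOnCompacts γ.toMeasure := by
  refine ⟨fun K hK => ?_⟩
  rw [γ.toMeasure_apply hK.measurableSet, tsum_subtype γ.1 (K.indicator 1), indicator_indicator,
    ← tsum_subtype]
  have := (γ.finite_inter hK).fintype
  rw [tsum_fintype]
  simp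

theorem Config.measurable_toMeasure : Measurable (Config.toMeasure (X := X)) :=
  measurable_vagueBorel _ Config.isFiniteMeasureOnCompacts

theorem Config.measurable_indicator {Λ : Set X} (hΛ : MeasurableSet Λ) :
    Measurable fun y : PosReal × X => Λ.indicator (fun _ => ENNReal.ofReal (y.1 : ℝ)) y.2 := by
  have : (fun y : PosReal × X => Λ.indicator (fun _ => ENNReal.ofReal (y.1 : ℝ)) y.2) =
      (Prod.snd ⁻¹' Λ).indicator fun y : PosReal × X => ENNReal.ofReal (y.1 : ℝ) := by
    ext y
    by_cases h : y.2 ∈ Λ <;> simp [h]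
  rw [this]
  exact (by fun_prop : Measurable fun y : PosReal × X => ENNReal.ofReal (y.1 : ℝ)).indicator
    (measurable_snd hΛ)

theorem Config.weighted_apply (γ : Config X) {Λ : Set X} (hΛ : MeasurableSet Λ) :
    γ.weighted Λ = γ.localMass Λ := by
  rw [Config.weighted, Config.localMass, Config.toMeasure, lintegral_sum_measure,
    Measure.sum_apply _ hΛ]
  refine tsum_congr fun y => ?_
  rw [lintegral_dirac' _ (Config.measurable_indicator hΛ)]
  by_cases h : y.1.2 ∈ Λ <;> simp [Measure.dirac_apply' _ hΛ, h]

theorem Config.weighted_mem_cone (γ : Config X) (hγ : γ ∈ finiteMassConfigs X) :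
    IsFiniteMeasureOnCompacts γ.weighted ∧
    ∃ (S : Set X) (s : X → ℝ), S.Countable ∧ (∀ x ∈ S, 0 < s x) ∧
      γ.weighted = Measure.sum fun x : S => ENNReal.ofReal (s x) • Measure.dirac x.1 := by
  classical
  obtain ⟨hp, hm⟩ := hγ
  refine ⟨⟨fun K hK => ?_⟩, Prod.snd '' γ.1,
    fun x => if h : ∃ y ∈ γ.1, y.2 = x then (h.choose.1 : ℝ) else 0, γ.countable.image _, ?_, ?_⟩
  · show γ.weighted K < ∞
    rw [γ.weighted_apply hK.measurableSet]
    exact hm K ⟨hK.measurableSet, by rwa [hK.isClosed.closure_eq]⟩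
  · rintro _ ⟨y, hy, rfl⟩
    have h : ∃ z ∈ γ.1, z.2 = y.2 := ⟨y, hy, rfl⟩
    simp only [h, dif_pos]
    exact h.choose.1.2
  · have hinj : InjOn Prod.snd γ.1 := fun y hy z hz h => Prod.ext (hp y hy z hz h) h
    let e : γ.1 ≃ (Prod.snd '' γ.1 : Set X) := Equiv.Set.imageOfInjOn _ _ hinj
    ext A hA
    rw [Measure.sum_apply _ hA, Config.weighted, Measure.sum_apply _ hA, ← e.tsum_eq]
    refine tsum_congr fun y => ?_
    have he : (e y).1 = y.1.2 := rfl
    have h : ∃ z ∈ γ.1, z.2 = y.1.2 := ⟨y, y.2, rfl⟩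
    have hy : h.choose.1 = y.1.1 := hp _ h.choose_spec.1 _ y.2 h.choose_spec.2
    simp only [he, dif_pos h, hy]

/-- The bijection `∑ δ_{(s, x)} ↦ ∑ s δ_x` from pinpointing configurations with finite local mass
onto the cone. -/
noncomputable def toCone (γ : finiteMassConfigs X) : Cone X :=
  ⟨γ.1.weighted, γ.1.weighted_mem_cone γ.2⟩

theorem measurable_toCone : Measurable (toCone (X := X)) := by
  refine Measurable.mono (ma := inferInstance)
    (mb := MeasurableSpace.comap (fun η : Cone X => η.1) inferInstance) ?_ le_rfl
    (vagueBorel_le _ fun η => η.2.1)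
  rw [measurable_comap_iff]
  refine Measure.measurable_of_measurable_coe _ fun A hA => ?_
  have : (fun γ : finiteMassConfigs X => γ.1.weighted A) = fun γ => γ.1.localMass A := by
    ext γ
    exact γ.1.weighted_apply hA
  show Measurable fun γ : finiteMassConfigs X => γ.1.weighted A
  rw [this]
  exact ((Measure.measurable_lintegral (Config.measurable_indicator hA)).comp
    Config.measurable_toMeasure).comp measurable_subtype_coe

theorem Config.exists_kernel : ∃ κ : ℕ → ProbabilityTheory.Kernel (Config X) (PosReal × X),
    (∀ n, ProbabilityTheory.IsFiniteKernel (κ n)) ∧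
    ∀ n (γ : Config X) A, MeasurableSet A → (κ n γ A = 0 ↔
      ∀ y ∈ γ.1, y ∈ compactCovering (PosReal × X) n → y ∉ A) := by
  let C := compactCovering (PosReal × X)
  have hC : ∀ n, IsCompact (C n) := isCompact_compactCovering _
  have hlt : ∀ (γ : Config X) n, γ.toMeasure (C n) < ∞ := fun γ n => by
    have := γ.isFiniteMeasureOnCompacts
    exact (hC n).measure_lt_top
  let κ : ℕ → ProbabilityTheory.Kernel (Config X) (PosReal × X) := fun n =>
    { toFun := fun γ => (γ.toMeasure (C n))⁻¹ • γ.toMeasure.restrict (C n)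
      measurable' := by
        have hm := fun (A : Set (PosReal × X)) (hA : MeasurableSet A) =>
          (Measure.measurable_coe hA).comp (Config.measurable_toMeasure (X := X))
        refine Measure.measurable_of_measurable_coe _ fun A hA => ?_
        simp only [Measure.smul_apply, Measure.restrict_apply hA, smul_eq_mul]
        exact (hm _ (hC n).measurableSet).inv.mul (hm _ (hA.inter (hC n).measurableSet)) }
  have hκ : ∀ n (γ : Config X) A, MeasurableSet A →
      (κ n γ A = 0 ↔ ∀ y ∈ γ.1, y ∈ C n → y ∉ A) := by
    intro n γ A hA
    have : κ n γ A = (γ.toMeasure (C n))⁻¹ * γ.toMeasure (A ∩ C n) := by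
      show ((γ.toMeasure (C n))⁻¹ • γ.toMeasure.restrict (C n)) A = _
      simp [Measure.restrict_apply hA]
    rw [this, mul_eq_zero, ENNReal.inv_eq_zero, or_iff_right (hlt γ n).ne,
      γ.toMeasure_eq_zero_iff (hA.inter (hC n).measurableSet)]
    simp only [mem_inter_iff, not_and']
  have hfin : ∀ n, ProbabilityTheory.IsFiniteKernel (κ n) := fun n =>
    ⟨1, ENNReal.one_lt_top, fun γ => by
      show ((γ.toMeasure (C n))⁻¹ • γ.toMeasure.restrict (C n)) univ ≤ 1
      simp [ENNReal.inv_mul_le_one]⟩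
  exact ⟨κ, hfin, hκ⟩

theorem measurableSet_isPinpointing : MeasurableSet {γ : Config X | γ.IsPinpointing} := by
  let D : Set ((PosReal × X) × (PosReal × X)) := {p | p.1.2 = p.2.2 ∧ p.1.1 ≠ p.2.1}
  have hD : MeasurableSet D :=
    (measurableSet_eq_fun (by fun_prop) (by fun_prop)).inter
      (measurableSet_eq_fun (by fun_prop) (by fun_prop)).compl
  obtain ⟨κ, hfin, hκ⟩ := Config.exists_kernel (X := X)
  have hmeas : ∀ n, Measurable fun p : Config X × (PosReal × X) =>
      κ n p.1 {z | (p.2, z) ∈ D} := by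
    intro n
    have := ProbabilityTheory.Kernel.measurable_kernel_prodMk_left
      (κ := (κ n).comap Prod.fst (measurable_fst (β := PosReal × X)))
      (t := {q | (q.1.2, q.2) ∈ D})
      (hD.preimage (by fun_prop : Measurable
        fun q : (Config X × (PosReal × X)) × (PosReal × X) => (q.1.2, q.2)))
    exact this
  have hset : {γ : Config X | γ.IsPinpointing} =
      ⋂ n, {γ | ∫⁻ y, κ n γ {z | (y, z) ∈ D} ∂(κ n γ) = 0} := by
    ext γ
    have hsec : ∀ y, MeasurableSet {z | (y, z) ∈ D} := fun y => measurable_prodMk_left hD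
    have hg : ∀ n, Measurable fun y => κ n γ {z | (y, z) ∈ D} := fun n =>
      (hmeas n).comp measurable_prodMk_left
    simp only [mem_iInter, mem_setOf_eq]
    have : ∀ n, (∫⁻ y, κ n γ {z | (y, z) ∈ D} ∂(κ n γ) = 0 ↔
        ∀ y ∈ γ.1, y ∈ compactCovering (PosReal × X) n →
          ∀ z ∈ γ.1, z ∈ compactCovering (PosReal × X) n → (y, z) ∉ D) := by
      intro n
      have h0 : MeasurableSet {y | κ n γ {z | (y, z) ∈ D} = 0}ᶜ :=
        ((hg n) (measurableSet_singleton 0)).compl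
      rw [lintegral_eq_zero_iff (hg n)]
      refine (hκ n γ _ h0).trans ?_
      refine forall₃_congr fun y _ _ => ?_
      refine not_not.trans ?_
      exact hκ n γ _ (hsec y)
    simp_rw [this]
    constructor
    · intro h n y hy _ z hz _ hd
      exact hd.2 (h y hy z hz hd.1)
    · intro h y hy z hz hyz
      obtain ⟨i, hi⟩ := exists_mem_compactCovering y
      obtain ⟨j, hj⟩ := exists_mem_compactCovering z
      by_contra hne
      exact h (max i j) y hy (compactCovering_subset _ (le_max_left i j) hi) z hz
        (compactCovering_subset _ (le_max_right i j) hj) ⟨hyz, hne⟩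
  rw [hset]
  refine MeasurableSet.iInter fun n => measurableSet_eq_fun ?_ measurable_const
  exact (hmeas n).lintegral_kernel_prod_right'

theorem measurableSet_finiteMassConfigs : MeasurableSet (finiteMassConfigs X) := by
  have E : CompactExhaustion X := default
  have hset : finiteMassConfigs X =
      {γ : Config X | γ.IsPinpointing} ∩ ⋂ n, {γ | γ.localMass (E n) < ∞} := by
    ext γ
    simp only [mem_inter_iff, mem_iInter]
    refine and_congr_right fun _ => ⟨fun h n => h _ ⟨(E.isCompact n).measurableSet, ?_⟩, ?_⟩
    · rw [(E.isCompact n).isClosed.closure_eq]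
      exact E.isCompact n
    · intro h Λ hΛ
      obtain ⟨n, hn⟩ := E.exists_superset_of_isCompact hΛ.2
      rw [← γ.weighted_apply hΛ.1]
      refine (measure_mono (subset_closure.trans hn)).trans_lt ?_
      rw [γ.weighted_apply (E.isCompact n).measurableSet]
      exact h n
  rw [hset]
  refine measurableSet_isPinpointing.inter (MeasurableSet.iInter fun n => ?_)
  exact measurableSet_lt ((Measure.measurable_lintegral
    (Config.measurable_indicator (E.isCompact n).measurableSet)).comp
      Config.measurable_toMeasure) measurable_const

/-- The measure on the cone induced by a measure `P` on configurations: `P` is regarded as a measure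
on the (measurable) set of pinpointing configurations with finite local mass and is pushed forward
along the (measurable) map `toCone`. -/
noncomputable def coneMeasure (P : Measure (Config X)) : Measure (Cone X) :=
  (P.comap (Subtype.val : finiteMassConfigs X → Config X)).map toCone

end Polish

end DiscreteCone

namespace DiscreteCone

/-! Write N(A) for the number of points of the configuration in A and ρ for the intensity. For
compact A, approximating the indicator of A by continuous functions in the Laplace formula gives E
exp(-N(A)) = exp(-(1 - e⁻¹) ρ(A)) (`IsPoissonMeasure.integral_exp_neg`). This single Laplace value
suffices; neither the law of N(A) nor independence over disjoint sets is needed. If compact sets A n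
increase to a set U with ρ(U) = ∞, Markov's inequality bounds P(N(U) ≤ M) by e^M exp(-(1 - e⁻¹) ρ(A
n)), which tends to 0, so N(U) = ∞ almost surely (`IsPoissonMeasure.ae_toMeasure_iUnion_eq_top`).

Inner regularity of σ supplies a compact K ⊆ Λ with σ(K) > 0, and U = (0, ∞) × K has intensity ∞ ·
σ(K) = ∞. In a pinpointing configuration, distinct points have distinct positions and each position
is an atom of the image measure, so infinitely many points over K give infinitely many atoms in Λ
(`infinite_support_toCone`).

To move the almost sure statement through the image measure, the event on the cone must be
measurable. This is `measurableSet_infinite_support`, where the number of atoms is written as an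
integral against a kernel. -/

/-- If `f` is a `[0, 1]`-valued compactly supported continuous function with `{f = 1} = A`, then the
integrals of `g ∘ f ^ (n + 1)` converge to `g 1 * μ A`, for continuous `g` with `|g t| ≤ |t|`
on `[0, 1]`. -/
theorem tendsto_integral_comp_pow {Y : Type*} [TopologicalSpace Y] [MeasurableSpace Y]
    [BorelSpace Y] (μ : Measure Y) [IsFiniteMeasureOnCompacts μ] {A : Set Y}
    (hA : MeasurableSet A) {f : Y → ℝ} (hfc : Continuous f) (hf : HasCompactSupport f)
    (h01 : ∀ y, f y ∈ Icc (0 : ℝ) 1) (hfA : ∀ y, f y = 1 ↔ y ∈ A) {g : ℝ → ℝ}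
    (hg : Continuous g) (hgt : ∀ t ∈ Icc (0 : ℝ) 1, |g t| ≤ t) :
    Tendsto (fun n : ℕ => ∫ y, g (f y ^ (n + 1)) ∂μ) atTop (𝓝 (g 1 * μ.real A)) := by
  have hlim : Tendsto (fun n : ℕ => ∫ y, g (f y ^ (n + 1)) ∂μ) atTop
      (𝓝 (∫ y, A.indicator (fun _ => g 1) y ∂μ)) := by
    refine tendsto_integral_of_dominated_convergence f
      (fun n => (hg.comp (hfc.pow (n + 1))).aestronglyMeasurable)
      (hfc.integrable_of_hasCompactSupport hf) (fun n => ae_of_all _ fun y => ?_)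
      (ae_of_all _ fun y => ?_)
    · refine (hgt _ ⟨pow_nonneg (h01 y).1 _, pow_le_one₀ (h01 y).1 (h01 y).2⟩).trans ?_
      exact pow_le_of_le_one (h01 y).1 (h01 y).2 (by simp)
    · by_cases hy : y ∈ A
      · simp [hy, (hfA y).2 hy]
      · rw [indicator_of_notMem hy]
        -- The bound `hgt` at t = 0 forces this, so the integrand vanishes in the limit off `A`.
        have h0 : g 0 = 0 := by simpa using hgt 0 (by simp)
        rw [← h0]
        exact (hg.tendsto 0).comp ((tendsto_pow_atTop_nhds_zero_of_lt_one (h01 y).1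
          (lt_of_le_of_ne (h01 y).2 fun h => hy ((hfA y).1 h))).comp (tendsto_add_atTop_nat 1))
  rwa [integral_indicator hA, setIntegral_const, smul_eq_mul, mul_comm] at hlim

/-- Each atom contributes (μ {x})⁻¹ μ {x} = 1, so the integral counts atoms. Cardinality in this
form falls under the measurability of kernel integrals. -/
theorem lintegral_inv_measure_singleton {X : Type*} [MeasurableSpace X]
    [MeasurableSingletonClass X] (μ : Measure X) {B : Set X} (hB : B.Countable)
    (hμB : μ Bᶜ = 0) (hpos : ∀ x ∈ B, μ {x} ≠ 0) (hfin : ∀ x ∈ B, μ {x} ≠ ∞) :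
    ∫⁻ x, (μ {x})⁻¹ ∂μ = ∑' _ : B, (1 : ℝ≥0∞) := by
  have : μ.restrict B = μ := Measure.restrict_eq_self_of_ae_mem (mem_ae_iff.2 hμB)
  calc ∫⁻ x, (μ {x})⁻¹ ∂μ = ∫⁻ x in B, (μ {x})⁻¹ ∂μ := by rw [this]
    _ = ∑' x : B, (μ {x.1})⁻¹ * μ {x.1} := lintegral_countable _ hB
    _ = _ := tsum_congr fun x => ENNReal.inv_mul_cancel (hpos x x.2) (hfin x x.2)

section Polish

variable {X : Type*} [TopologicalSpace X] [PolishSpace X] [LocallyCompactSpace X]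
  [MeasurableSpace X] [BorelSpace X]

/-! ### Poisson counts on compact sets and their increasing unions. -/

/-- The Laplace formula is applied to continuous functions decreasing to the indicator of `A`;
dominated convergence applies on both sides. -/
theorem IsPoissonMeasure.integral_exp_neg {ρ : Measure (PosReal × X)}
    [IsFiniteMeasureOnCompacts ρ] {P : Measure (Config X)} (hP : IsPoissonMeasure ρ P)
    {A : Set (PosReal × X)} (hA : IsCompact A) :
    ∫ γ, Real.exp (-γ.toMeasure.real A) ∂P = Real.exp ((Real.exp (-1) - 1) * ρ.real A) := by
  -- Metrizability makes the closed set `A` a Gδ, so the Urysohn function can equal 1 exactly on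
  -- `A`.
  let := TopologicalSpace.metrizableSpaceMetric X
  let : TopologicalSpace (Config X) := vagueTopology Config.toMeasure
  have : BorelSpace (Config X) := ⟨rfl⟩
  have := hP.isProbabilityMeasure
  obtain ⟨f, hf1, -, hc, h01⟩ := exists_continuous_one_zero_of_isCompact_of_isGδ hA
    hA.isClosed.isGδ isClosed_empty (disjoint_empty _)
  have hfA : ∀ y, f y = 1 ↔ y ∈ A := fun y => by rw [hf1]; simp
  -- The exponent n + 1 avoids the zeroth power, the constant 1, which need not have compact
  -- support.
  have hp : ∀ n : ℕ, HasCompactSupport (fun y => f y ^ (n + 1)) := fun n =>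
    hc.comp_left (g := fun x : ℝ => x ^ (n + 1)) (by simp)
  have hcont : ∀ n : ℕ, Continuous (fun y => f y ^ (n + 1)) := fun n => by fun_prop
  let F : ℕ → C_c(PosReal × X, ℝ) := fun n => ⟨⟨_, hcont n⟩, hp n⟩
  have hF : ∀ n y, F n y = f y ^ (n + 1) := fun n y => rfl
  have hF0 : ∀ n y, 0 ≤ F n y := fun n y => pow_nonneg (h01 y).1 _
  have hleft : Tendsto (fun n => ∫ γ, Real.exp (-∫ y, F n y ∂γ.toMeasure) ∂P) atTop
      (𝓝 (∫ γ, Real.exp (-γ.toMeasure.real A) ∂P)) := by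
    refine tendsto_integral_of_dominated_convergence (fun _ => 1) (fun n => ?_)
      (integrable_const _) (fun n => ae_of_all _ fun γ => ?_) (ae_of_all _ fun γ => ?_)
    · exact (Real.measurable_exp.comp
        (continuous_vague_integral Config.toMeasure (F n)).measurable.neg).aestronglyMeasurable
    · rw [Real.norm_of_nonneg (Real.exp_nonneg _), Real.exp_le_one_iff, neg_nonpos]
      exact integral_nonneg (hF0 n)
    · have := γ.isFiniteMeasureOnCompacts
      have h := tendsto_integral_comp_pow γ.toMeasure hA.measurableSet f.continuous hc h01 hfA
        continuous_id (fun t ht => (abs_of_nonneg ht.1).le)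
      simp only [id, one_mul] at h
      exact (Real.continuous_exp.tendsto _).comp h.neg
  have hright : Tendsto (fun n => Real.exp (∫ y, (Real.exp (-F n y) - 1) ∂ρ)) atTop
      (𝓝 (Real.exp ((Real.exp (-1) - 1) * ρ.real A))) := by
    refine (Real.continuous_exp.tendsto _).comp ?_
    refine tendsto_integral_comp_pow ρ hA.measurableSet f.continuous hc h01 hfA
      (g := fun t => Real.exp (-t) - 1) (by fun_prop) fun t ht => ?_
    have h1 : Real.exp (-t) ≤ 1 := Real.exp_le_one_iff.2 (neg_nonpos.2 ht.1)
    have h2 := Real.add_one_le_exp (-t)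
    rw [abs_le]
    constructor <;> linarith [ht.1]
  simp_rw [fun n => hP.laplace (F n) (hF0 n)] at hleft
  exact tendsto_nhds_unique hleft hright

/-- A Poisson configuration almost surely has infinitely many points in an increasing union of
compact sets of infinite intensity. -/
theorem IsPoissonMeasure.ae_toMeasure_iUnion_eq_top {ρ : Measure (PosReal × X)}
    [IsFiniteMeasureOnCompacts ρ] {P : Measure (Config X)} (hP : IsPoissonMeasure ρ P)
    {A : ℕ → Set (PosReal × X)} (hA : ∀ n, IsCompact (A n)) (hmono : Monotone A)
    (hρ : ρ (⋃ n, A n) = ∞) : ∀ᵐ γ ∂P, γ.toMeasure (⋃ n, A n) = ∞ := by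
  have := hP.isProbabilityMeasure
  have hreal : Tendsto (fun n => ρ.real (A n)) atTop atTop := by
    have h := tendsto_measure_iUnion_atTop (μ := ρ) hmono
    rw [hρ, ENNReal.tendsto_nhds_top_iff_nnreal] at h
    refine tendsto_atTop.2 fun b => ?_
    filter_upwards [h b.toNNReal] with n hn
    exact (Real.le_coe_toNNReal b).trans
      (ENNReal.toReal_mono (hA n).measure_lt_top.ne hn.le)
  have hexp : Tendsto (fun n => Real.exp ((Real.exp (-1) - 1) * ρ.real (A n))) atTop (𝓝 0) := by
    refine Real.tendsto_exp_atBot.comp (hreal.const_mul_atTop_of_neg ?_)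
    have : Real.exp (-1) < 1 := by simp
    linarith
  have hmeas : ∀ B : Set (PosReal × X), MeasurableSet B →
      Measurable fun γ : Config X => Real.exp (-γ.toMeasure.real B) := fun B hB =>
    Real.measurable_exp.comp
      ((Measure.measurable_coe hB).comp Config.measurable_toMeasure).ennreal_toReal.neg
  have hnull : ∀ M : ℕ, P {γ | γ.toMeasure (⋃ n, A n) ≤ M} = 0 := by
    intro M
    have hle : ∀ n, P.real {γ | γ.toMeasure (⋃ n, A n) ≤ M} ≤
        Real.exp M * Real.exp ((Real.exp (-1) - 1) * ρ.real (A n)) := by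
      intro n
      have hint : Integrable (fun γ : Config X => Real.exp (-γ.toMeasure.real (A n))) P :=
        Integrable.of_bound (hmeas _ (hA n).measurableSet).aestronglyMeasurable 1
          (ae_of_all _ fun γ => by
            rw [Real.norm_of_nonneg (Real.exp_nonneg _), Real.exp_le_one_iff, neg_nonpos]
            exact measureReal_nonneg)
      -- Exponential Markov inequality: at most `M` points in the union means at most `M` in `A n`,
      -- that is, exp(-N(A n)) ≥ exp(-M).
      have hmarkov := mul_meas_ge_le_integral_of_nonneg
        (ae_of_all P fun γ : Config X => Real.exp_nonneg (-γ.toMeasure.real (A n))) hint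
        (Real.exp (-M))
      rw [hP.integral_exp_neg (hA n)] at hmarkov
      have hsub : P.real {γ | γ.toMeasure (⋃ n, A n) ≤ M} ≤
          P.real {γ | Real.exp (-M) ≤ Real.exp (-γ.toMeasure.real (A n))} := by
        refine measureReal_mono fun γ hγ => ?_
        rw [mem_ofPred_eq, Real.exp_le_exp, neg_le_neg_iff]
        exact ENNReal.toReal_le_of_le_ofReal (by positivity)
          (((measure_mono (subset_iUnion A n)).trans hγ).trans (by simp))
      refine hsub.trans ?_
      calc _ = Real.exp M * (Real.exp (-M) * P.real
              {γ | Real.exp (-M) ≤ Real.exp (-γ.toMeasure.real (A n))}) := by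
            rw [← mul_assoc, ← Real.exp_add]; simp
        _ ≤ _ := by gcongr
    have h0 : P.real {γ | γ.toMeasure (⋃ n, A n) ≤ M} ≤ 0 :=
      ge_of_tendsto' (by simpa using hexp.const_mul (Real.exp M)) hle
    exact (measureReal_eq_zero_iff).1 (le_antisymm h0 measureReal_nonneg)
  -- A finite count lies below some natural number, so the exceptional set is a countable union of
  -- null sets.
  rw [ae_iff]
  refine measure_mono_null (fun γ (hγ : ¬ _ = ∞) => ?_) (measure_iUnion_null hnull)
  obtain ⟨M, hM⟩ := ENNReal.exists_nat_gt hγ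
  exact mem_iUnion.2 ⟨M, hM.le⟩

/-! ### From infinitely many points to infinitely many atoms. -/

theorem Config.infinite_inter_of_toMeasure_eq_top (γ : Config X) {A : Set (PosReal × X)}
    (hA : MeasurableSet A) (h : γ.toMeasure A = ∞) : (γ.1 ∩ A).Infinite := by
  intro hfin
  rw [γ.toMeasure_apply hA, tsum_subtype γ.1 (A.indicator 1), indicator_indicator,
    ← tsum_subtype] at h
  have := hfin.fintype
  rw [tsum_fintype] at h
  simp at h

theorem infinite_support_toCone (γ : finiteMassConfigs X) {Λ : Set X}
    (h : (γ.1.1 ∩ univ ×ˢ Λ).Infinite) : ((toCone γ).support ∩ Λ).Infinite := by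
  have hinj : InjOn Prod.snd (γ.1.1 ∩ univ ×ˢ Λ) := fun y hy z hz hyz =>
    Prod.ext (γ.2.1 y hy.1 z hz.1 hyz) hyz
  refine (h.image hinj).mono ?_
  rintro _ ⟨y, ⟨hy, hyΛ⟩, rfl⟩
  refine ⟨?_, hyΛ.2⟩
  show 0 < γ.1.weighted {y.2}
  rw [Config.weighted, Measure.sum_apply _ (measurableSet_singleton _)]
  refine lt_of_lt_of_le ?_ (ENNReal.le_tsum (⟨y, hy⟩ : γ.1.1))
  have hs : 0 < (y.1 : ℝ) := y.1.2
  simpa using hs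

/-! ### Measurability of having infinitely many atoms in a set. -/

theorem Cone.countable_support (η : Cone X) : η.support.Countable := by
  obtain ⟨-, S, s, hS, -, hη⟩ := η.2
  refine hS.mono fun x hx => by_contra fun hxS => (show 0 < η.1 {x} from hx).ne' ?_
  rw [hη, Measure.sum_apply _ (measurableSet_singleton x), ENNReal.tsum_eq_zero]
  rintro ⟨y, hy⟩
  have : y ≠ x := fun h => hxS (h ▸ hy)
  simp [this]

theorem Cone.measure_compl_support (η : Cone X) : η.1 η.supportᶜ = 0 := by
  obtain ⟨-, S, s, hS, -, hη⟩ := η.2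
  have h1 : η.1 Sᶜ = 0 := by
    rw [hη, Measure.sum_apply _ hS.measurableSet.compl, ENNReal.tsum_eq_zero]
    rintro ⟨y, hy⟩
    simp [Measure.dirac_apply' _ hS.measurableSet.compl, hy]
  have h2 : η.1 (S \ η.support) = 0 := by
    have hc : (S \ η.support).Countable := hS.mono sdiff_subset
    rw [← biUnion_of_singleton (S \ η.support), measure_biUnion_null_iff hc]
    exact fun x hx => nonpos_iff_eq_zero.1 (not_lt.1 hx.2)
  refine measure_mono_null (fun x hx => ?_) (measure_union_null h1 h2)
  by_cases hxS : x ∈ S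
  exacts [Or.inr ⟨hxS, hx⟩, Or.inl hxS]

theorem Cone.measurable_val : Measurable fun η : Cone X => η.1 :=
  measurable_vagueBorel _ fun η => η.2.1

/-- The number of atoms in `Λ` is the integral of 1/κ({x}) against a finite kernel κ, hence a
measurable function of η. -/
theorem measurableSet_infinite_support {Λ : Set X} (hΛ : IsRelCompactBorel Λ) :
    MeasurableSet {η : Cone X | (η.support ∩ Λ).Infinite} := by
  have hlt : ∀ η : Cone X, η.1 Λ < ∞ := fun η => by
    have := η.2.1
    exact (measure_mono subset_closure).trans_lt hΛ.2.measure_lt_top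
  -- Normalizing by η(Λ) bounds the total masses uniformly, as a finite kernel requires, and the
  -- factor cancels in the atom count. If η(Λ) = 0 the convention ∞ · 0 = 0 gives the zero measure.
  let κ : ProbabilityTheory.Kernel (Cone X) X :=
    { toFun := fun η => (η.1 Λ)⁻¹ • η.1.restrict Λ
      measurable' := by
        have hm := fun (A : Set X) (hA : MeasurableSet A) =>
          (Measure.measurable_coe hA).comp (Cone.measurable_val (X := X))
        refine Measure.measurable_of_measurable_coe _ fun A hA => ?_
        simp only [Measure.smul_apply, Measure.restrict_apply hA, smul_eq_mul]
        exact (hm _ hΛ.1).inv.mul (hm _ (hA.inter hΛ.1)) }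
  have hκ : ∀ η A, MeasurableSet A → κ η A = (η.1 Λ)⁻¹ * η.1 (A ∩ Λ) := by
    intro η A hA
    show ((η.1 Λ)⁻¹ • η.1.restrict Λ) A = _
    simp [Measure.restrict_apply hA]
  have hfin : ProbabilityTheory.IsFiniteKernel κ :=
    ⟨1, ENNReal.one_lt_top, fun η => by
      rw [hκ η _ MeasurableSet.univ, univ_inter]
      exact ENNReal.inv_mul_le_one _⟩
  have hmeas : Measurable fun p : Cone X × X => (κ p.1 {p.2})⁻¹ := by
    -- The singleton {x} is a section of the measurable diagonal, which gives joint measurability in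
    -- (η, x).
    have := ProbabilityTheory.Kernel.measurable_kernel_prodMk_left
      (κ := κ.comap Prod.fst (measurable_fst (β := X)))
      (t := {q | q.2 = q.1.2}) (measurableSet_eq_fun (by fun_prop) (by fun_prop))
    exact this.inv
  have hcount : ∀ η : Cone X,
      ∫⁻ x, (κ η {x})⁻¹ ∂(κ η) = ∑' _ : (η.support ∩ Λ : Set X), (1 : ℝ≥0∞) := by
    intro η
    have hc : (η.support ∩ Λ).Countable := η.countable_support.mono inter_subset_left
    refine lintegral_inv_measure_singleton (κ η) hc ?_ (fun x hx => ?_) fun x _ =>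
      measure_ne_top _ _
    · rw [hκ η _ hc.measurableSet.compl]
      refine mul_eq_zero_of_right _ (measure_mono_null (fun x hx => ?_) η.measure_compl_support)
      exact fun h => hx.1 ⟨h, hx.2⟩
    · rw [hκ η _ (measurableSet_singleton x), inter_eq_left.2 (singleton_subset_iff.2 hx.2)]
      exact mul_ne_zero (ENNReal.inv_ne_zero.2 (hlt η).ne) hx.1.ne'
  have hset : {η : Cone X | (η.support ∩ Λ).Infinite} =
      {η | ∫⁻ x, (κ η {x})⁻¹ ∂(κ η) = ∞} := by
    ext η
    rw [mem_ofPred_eq, mem_ofPred_eq, hcount, ENNReal.tsum_const, mul_one, ENat.toENNReal_eq_top,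
      ENat.card_eq_top, infinite_coe_iff]
  rw [hset]
  exact hmeas.lintegral_kernel_prod_right' (measurableSet_singleton ∞)

end Polish

end DiscreteCone

theorem mainTheorem9 {X : Type*} [TopologicalSpace X] [PolishSpace X] [LocallyCompactSpace X]
    [MeasurableSpace X] [BorelSpace X]
    (ν : Measure DiscreteCone.PosReal) (σ : Measure X)
    [IsFiniteMeasureOnCompacts ν] [IsFiniteMeasureOnCompacts σ] [NullSingletonClass ν] [NullSingletonClass σ]
    (hν_moment : ∫⁻ s : DiscreteCone.PosReal, ENNReal.ofReal (s : ℝ) ∂ν < ∞)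
    (hν_infinite : ν Set.univ = ∞)
    (P : Measure (DiscreteCone.Config X)) (hP : DiscreteCone.IsPoissonMeasure (ν.prod σ) P)
    (Λ : Set X) (hΛ : DiscreteCone.IsRelCompactBorel Λ) (hσΛ : 0 < σ Λ) :
    ∀ᵐ η ∂(DiscreteCone.coneMeasure P), (η.support ∩ Λ).Infinite := by
  -- `Λ` need not be closed; a compact subset of positive measure makes the boxes `A n` compact.
  obtain ⟨K, hKΛ, hK, hσK⟩ := hΛ.1.exists_lt_isCompact hσΛ
  let A : ℕ → Set (DiscreteCone.PosReal × X) := fun n =>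
    compactCovering DiscreteCone.PosReal n ×ˢ K
  have hA : ∀ n, IsCompact (A n) := fun n => (isCompact_compactCovering _ n).prod hK
  have hmono : Monotone A := fun m n h => prod_mono_left (compactCovering_subset _ h)
  have hU : ⋃ n, A n = univ ×ˢ K := by
    rw [← iUnion_prod_const, iUnion_compactCovering]
  have hinf : ∀ᵐ γ ∂P, (γ.1 ∩ univ ×ˢ Λ).Infinite := by
    have h := hP.ae_toMeasure_iUnion_eq_top hA hmono (by
      rw [hU, Measure.prod_prod, hν_infinite, ENNReal.top_mul hσK.ne'])
    filter_upwards [h] with γ hγ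
    rw [hU] at hγ
    exact (γ.infinite_inter_of_toMeasure_eq_top (MeasurableSet.univ.prod hK.measurableSet)
      hγ).mono (inter_subset_inter_right _ (prod_mono_right hKΛ))
  rw [DiscreteCone.coneMeasure, ae_map_iff DiscreteCone.measurable_toCone.aemeasurable
    (DiscreteCone.measurableSet_infinite_support hΛ)]
  have hemb := MeasurableEmbedding.subtype_coe
    (DiscreteCone.measurableSet_finiteMassConfigs (X := X))
  have hcomap : ∀ᵐ γ ∂(P.comap (Subtype.val : DiscreteCone.finiteMassConfigs X → _)),
      (γ.1.1 ∩ univ ×ˢ Λ).Infinite := by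
    -- Pushing the comap forward again gives the restriction of `P` to `finiteMassConfigs`, which
    -- inherits almost sure statements from `P`.
    rw [← hemb.ae_map_iff (p := fun γ => (γ.1 ∩ univ ×ˢ Λ).Infinite), hemb.map_comap]
    exact ae_restrict_of_ae hinf
  filter_upwards [hcomap] with γ hγ
  exact DiscreteCone.infinite_support_toCone γ hγ
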